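/- Let $\Omega\subset\mathbb R^n$ be a bounded convex $G_\delta$-set with non-empty interior and let $\rho$ be a metric on $\Omega$ such that: (i) $\rho$ induces the Euclidean topology; (ii) line segments are geodesics, i.e. $\rho(x,z)+\rho(z,y)=\rho(x,y)$ whenever $z\in[x,y]$; (iii) the Lebesgue measure $\mathcal L^n$ is locally doubling on $(\Omega,\rho)$, i.e. for every $R>0$ there is $C_R\ge 1$ with $\mathcal L^n(B_\rho(x,2s))\le C_R\,\mathcal L^n(B_\rho(x,s))$ for all $x\in\Omega$, $0<s\le R$. Here $B_\rho$ denotes the open balls of $(\Omega,\rho)$, while $B(\cdot,\cdot)$ denotes open Euclidean balls (relative to $\Omega$, except in the final formula, where $B(x,\delta)$ is a ball of $\mathbb R^n$). Let $\mu_1,\mu_2$ be Borel probability measures on $\Omega$ with compact support, with $\mu_1\ll\mathcal L^n$. Let $W_1$ be the $L^1$-Wasserstein distance for $\rho$, and let $C\ge1$ be a doubling constant of $\operatorname{supp}\mu_2$, i.e. $\mathcal L^n(B_\rho(x,2s))\le C\,\mathcal L^n(B_\rho(x,s))$ for all $x\in\operatorname{supp}\mu_2$ and $0<s\le\operatorname{diam}_\rho(\operatorname{supp}\mu_2)$.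 Put $d=\log_2C$. For $\varepsilon>0$ and a Borel probability measure $\pi$ on $\Omega^2$ put \[ C_\varepsilon(\pi)=\tfrac1\varepsilon W_1\big((\mathrm{pr}_2)_\sharp\pi,\mu_2\big)+\int_{\Omega^2}\big(\rho(x,y)+\varepsilon|x-y|^2\big)\,d\pi(x,y)+\varepsilon^{3d+2}\,\#\operatorname{supp}\big((\mathrm{pr}_2)_\sharp\pi\big)\in[0,\infty], \] and let $D_\varepsilon$ be the set of minimizers of $C_\varepsilon$ among all $\pi$ with $(\mathrm{pr}_1)_\sharp\pi=\mu_1$. Let $\mathcal O_2(\mu_1,\mu_2)$ be the set of all weak cluster points of sequences $\pi_k\in D_{\varepsilon_k}$ with $\varepsilon_k\to0^+$. The density of a finite Borel measure $\lambda$ on $\Omega$ is the function $z\mapsto\limsup_{s\to0^+}\lambda(B(z,s))/\mathcal L^n(B(z,s)\cap\Omega)$. Let $\pi\in\mathcal O_2(\mu_1,\mu_2)$ be concentrated on a $\sigma$-compact set $\Gamma\subset\Omega^2$, and let $f$ be the density of $\mu_1=(\mathrm{pr}_1)_\sharp\pi$. A point $(x,y)\in\Gamma$ is density-regular if for every $r>0$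 there are $\tilde y\in\Omega$, $\tilde r>0$ with $y\in B(\tilde y,\tilde r)\subset B(y,r)$ such that $x$ is a Lebesgue point of both $f$ and the density $\tilde f$ of $(\mathrm{pr}_1)_\sharp\big(\pi\lfloor_{\Omega\times B(\tilde y,\tilde r)}\big)$, $f(x)<+\infty$ and $\tilde f(x)>0$. For $G\subset\Omega^2$ let $\mathbb T(G)=\{(1-t)x+ty : t\in[0,1],\ (x,y)\in G\}$ be its transport set. Then for every density-regular point $(x,y)\in\Gamma$ with $x\ne y$ and every $r>0$, \[ \liminf_{\delta\to0^+}\frac{\mathcal L^n\Big(\mathbb T\big(\Gamma\cap(B(x,\delta/4)\times B(y,r))\big)\cap B(x,\delta)\Big)}{\mathcal L^n\big(B(x,\delta)\big)}>0 . \] -/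

import Mathlib

open MeasureTheory Filter Set Topology
open scoped ENNReal

noncomputable section

namespace MongeMetric

/-- The Euclidean space `ℝⁿ`. -/
abbrev Eucl (n : ℕ) : Type := EuclideanSpace ℝ (Fin n)

variable {n : ℕ} {Ω : Set (Eucl n)}

/-- The `n`-dimensional Lebesgue measure on `Ω`, as a measure on the subtype. -/
def leb (Ω : Set (Eucl n)) : Measure Ω :=
  (volume : Measure (Eucl n)).comap Subtype.val

/-- The open ball of `(Ω, ρ)`. (The balls `Metric.ball` below are always Euclidean.) -/
def rhoBall (ρ : Ω → Ω → ℝ) (x : Ω) (r : ℝ) : Set Ω := {y | ρ x y < r}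

/-- `ρ` is a metric on `Ω`. -/
structure IsMetric (ρ : Ω → Ω → ℝ) : Prop where
  eq_zero_iff : ∀ x y, ρ x y = 0 ↔ x = y
  symm : ∀ x y, ρ x y = ρ y x
  triangle : ∀ x y z, ρ x z ≤ ρ x y + ρ y z

/-- The measure `m` is locally doubling on `(Ω, ρ)`. -/
def IsLocallyDoubling (ρ : Ω → Ω → ℝ) (m : Measure Ω) : Prop :=
  ∀ R : ℝ, 0 < R → ∃ C : ℝ, 1 ≤ C ∧ ∀ (x : Ω) (r : ℝ), 0 < r → r ≤ R →
    m (rhoBall ρ x (2 * r)) ≤ ENNReal.ofReal C * m (rhoBall ρ x r)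

/-- The standing conditions on the metric `ρ`: it induces the Euclidean topology, line segments
are geodesics (`ρ` is additive along them), and Lebesgue measure is locally doubling. -/
structure AssumptionA (ρ : Ω → Ω → ℝ) : Prop where
  isOpen_iff : ∀ U : Set Ω, IsOpen U ↔ ∀ x ∈ U, ∃ r : ℝ, 0 < r ∧ rhoBall ρ x r ⊆ U
  segment_geodesic : ∀ x y z : Ω, (z : Eucl n) ∈ segment ℝ (x : Eucl n) (y : Eucl n) →
    ρ x z + ρ z y = ρ x y
  locally_doubling : IsLocallyDoubling ρ (leb Ω)

/-- `C` is a doubling constant of the (bounded) set `K`: the doubling inequality for Lebesgue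
measure holds with `C` at all centres in `K` and all radii up to the `ρ`-diameter of `K`
(when `K` is compact, `r ≤ diam K` means that `r ≤ ρ a b` for some `a, b ∈ K`). -/
def IsDoublingConstant (ρ : Ω → Ω → ℝ) (K : Set Ω) (C : ℝ) : Prop :=
  1 ≤ C ∧ ∀ x ∈ K, ∀ r : ℝ, 0 < r → (∃ a ∈ K, ∃ b ∈ K, r ≤ ρ a b) →
    leb Ω (rhoBall ρ x (2 * r)) ≤ ENNReal.ofReal C * leb Ω (rhoBall ρ x r)

/-- The set of transport plans from `μ` to `ν`. -/
def plans (μ ν : Measure Ω) : Set (ProbabilityMeasure (Ω × Ω)) :=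
  {π | (π : Measure (Ω × Ω)).map Prod.fst = μ ∧ (π : Measure (Ω × Ω)).map Prod.snd = ν}

/-- The `L¹`-Wasserstein distance for the metric `ρ`, with values in `[0, ∞]`. -/
def W1 (ρ : Ω → Ω → ℝ) (μ ν : Measure Ω) : ℝ≥0∞ :=
  ⨅ π ∈ plans μ ν, ∫⁻ p, ENNReal.ofReal (ρ p.1 p.2) ∂(π : Measure (Ω × Ω))

/-- The cost `c_ε(x, y) = ρ(x, y) + ε |x - y|²`. -/
def costEps (ρ : Ω → Ω → ℝ) (ε : ℝ) (x y : Ω) : ℝ :=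
  ρ x y + ε * ‖(x : Eucl n) - (y : Eucl n)‖ ^ 2

/-- The functional `C_ε` on `P(Ω²)`, with target `μ₂` and dimension parameter `d`. -/
def funcEps (ρ : Ω → Ω → ℝ) (μ₂ : Measure Ω) (d ε : ℝ) (π : ProbabilityMeasure (Ω × Ω)) : ℝ≥0∞ :=
  ENNReal.ofReal (1 / ε) * W1 ρ ((π : Measure (Ω × Ω)).map Prod.snd) μ₂
    + ∫⁻ p, ENNReal.ofReal (costEps ρ ε p.1 p.2) ∂(π : Measure (Ω × Ω))
    + ENNReal.ofReal (ε ^ (3 * d + 2))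
        * ((((π : Measure (Ω × Ω)).map Prod.snd).support.encard : ℕ∞) : ℝ≥0∞)

/-- The set `D_ε` of minimizers of `C_ε` among the probability measures on `Ω²` with first
marginal `μ₁`. -/
def minimizersEps (ρ : Ω → Ω → ℝ) (μ₁ μ₂ : Measure Ω) (d ε : ℝ) :
    Set (ProbabilityMeasure (Ω × Ω)) :=
  {π | (π : Measure (Ω × Ω)).map Prod.fst = μ₁ ∧
    ∀ π' : ProbabilityMeasure (Ω × Ω), (π' : Measure (Ω × Ω)).map Prod.fst = μ₁ →
      funcEps ρ μ₂ d ε π ≤ funcEps ρ μ₂ d ε π'}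

/-- The set `O₂(μ₁, μ₂)`: all cluster points, for the weak topology, of minimizers of `C_ε`
as `ε → 0⁺`. The parameter `d` of the functional is `log₂ C`. -/
def setO2 (ρ : Ω → Ω → ℝ) (C : ℝ) (μ₁ μ₂ : Measure Ω) : Set (ProbabilityMeasure (Ω × Ω)) :=
  {π | ∃ (ε : ℕ → ℝ) (p : ℕ → ProbabilityMeasure (Ω × Ω)),
    (∀ k, 0 < ε k) ∧ Tendsto ε atTop (𝓝 0) ∧
    (∀ k, p k ∈ minimizersEps ρ μ₁ μ₂ (Real.logb 2 C) (ε k)) ∧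
    MapClusterPt π atTop p}

/-- The density `limsup_{r → 0⁺} l(B(x, r)) / Lⁿ(B(x, r))` of a measure `l` on `Ω`. -/
def density (l : Measure Ω) (x : Ω) : ℝ≥0∞ :=
  limsup (fun r : ℝ => l (Metric.ball x r) / leb Ω (Metric.ball x r)) (𝓝[>] 0)

/-- `x` is a Lebesgue point of `f`: the mean of `|f - f(x)|` over `B(x, s)` tends to `0`. The
absolute difference of `a, b : ℝ≥0∞` is `(a - b) + (b - a)`, by truncated subtraction. -/
def IsLebesguePoint (f : Ω → ℝ≥0∞) (x : Ω) : Prop :=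
  Tendsto (fun s : ℝ =>
      (∫⁻ z in Metric.ball x s, ((f z - f x) + (f x - f z)) ∂(leb Ω)) / leb Ω (Metric.ball x s))
    (𝓝[>] 0) (𝓝 0)

/-- The set of density-regular points of `G`, for a plan `π` concentrated on `G`. -/
def densityRegular (π : Measure (Ω × Ω)) (G : Set (Ω × Ω)) : Set (Ω × Ω) :=
  {q | q ∈ G ∧ ∀ r : ℝ, 0 < r → ∃ (y' : Ω) (r' : ℝ), 0 < r' ∧
    q.2 ∈ Metric.ball y' r' ∧ Metric.ball y' r' ⊆ Metric.ball q.2 r ∧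
    IsLebesguePoint (density (π.map Prod.fst)) q.1 ∧
    IsLebesguePoint (density ((π.restrict (univ ×ˢ Metric.ball y' r')).map Prod.fst)) q.1 ∧
    density (π.map Prod.fst) q.1 < ∞ ∧
    0 < density ((π.restrict (univ ×ˢ Metric.ball y' r')).map Prod.fst) q.1}

/-- The transport set of `G`: the union of the segments `[x, y]` with `(x, y) ∈ G`. -/
def transportSet (G : Set (Ω × Ω)) : Set (Eucl n) :=
  {z | ∃ q ∈ G, ∃ t ∈ Icc (0 : ℝ) 1, z = (1 - t) • (q.1 : Eucl n) + t • (q.2 : Eucl n)}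

end MongeMetric

end

/-!
A minimizer `π_k` of `C_ε` has finite cost, so its second marginal is supported on finitely many
points, and it is an optimal plan for `c_ε` between its own marginals. Hence any two points of its
support satisfy the monotonicity inequality for `c_ε` (`support_monotone_of_optimal`,
`minimizersEps_spec`). As line segments are geodesics of `ρ`, two segments that cross at the same
time `t ∈ (0, 1)` leave only the quadratic part of this inequality, and strict convexity of the
square of the Euclidean norm shows that the two pairs coincide: the interpolation
`T_t (x, y) = (1 - t) x + t y` is injective on the support (`interp_injOn_of_monotone`). On the
points with a common target it is a homothety of ratio `1 - t`, and the finitely many images are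
disjoint, so `Lⁿ(T_t(G)) ≥ (1 - t)ⁿ Lⁿ(pr₁ G)` for subsets `G` of the support
(`leb_fst_image_le_volume_interp_image`).

This estimate survives in the limit (`exists_leb_lt_of_mem_setO2`): if `K ⊆ Ω × Ω` and `T_t(K)` has
volume less than `A`, then an open neighbourhood of `T_t(K)` still has, its preimage under `T_t` is
an open neighbourhood of `K`, and some minimizer gives it at least almost the mass `π(K)`. So there
is a set `S` of starting points with `μ₁(S)` almost as large as `π(K)` and `(1 - t)ⁿ Lⁿ(S) < A`.

Let now `K = Γ ∩ (B(x, δ / 4) × B(y, r))`, and let `t` be so small, proportionally to `δ`, that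
`T_t(K) ⊆ B(x, δ)`. At a density-regular point, `π(K)` is at least about `f̃(x) Lⁿ(B(x, δ / 4) ∩ Ω)`
(`eventually_le_measure_ball`), while `μ₁(S)` is at most about `f(x) Lⁿ(S)`, up to a small multiple
of `Lⁿ(B(x, δ / 4) ∩ Ω)` (`eventually_measure_le`); both rest on the fact that the densities are
Radon–Nikodym derivatives. So `Lⁿ(S)`, and with it the volume of `T_t(K)`, is at least a fixed
proportion of `Lⁿ(B(x, δ / 4) ∩ Ω)`, which by convexity of `Ω` is comparable to `δⁿ`
(`exists_volume_ball_le_leb_ball`).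
-/

namespace MongeMetric

/-! ### Continuity of the metric and of the cost -/

section Metric

variable {n : ℕ} {Ω : Set (Eucl n)} {ρ : Ω → Ω → ℝ}

lemma IsMetric.self_eq_zero (hρ : IsMetric ρ) (x : Ω) : ρ x x = 0 := (hρ.eq_zero_iff x x).2 rfl

lemma IsMetric.nonneg (hρ : IsMetric ρ) (x y : Ω) : 0 ≤ ρ x y := by
  linarith [hρ.triangle x y x, hρ.symm x y, hρ.self_eq_zero x]

lemma rhoBall_mem_nhds (hρ : IsMetric ρ) (hA : AssumptionA ρ) (x : Ω) {r : ℝ} (hr : 0 < r) :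
    rhoBall ρ x r ∈ 𝓝 x := by
  refine IsOpen.mem_nhds ((hA.isOpen_iff _).2 fun y hy => ?_) ?_
  · have hy' : ρ x y < r := hy
    refine ⟨r - ρ x y, by linarith, fun z hz => ?_⟩
    have hz' : ρ y z < r - ρ x y := hz
    change ρ x z < r
    linarith [hρ.triangle x y z]
  · change ρ x x < r
    rwa [hρ.self_eq_zero]

lemma continuous_rho (hρ : IsMetric ρ) (hA : AssumptionA ρ) :
    Continuous fun p : Ω × Ω => ρ p.1 p.2 := by
  rw [continuous_iff_continuousAt]
  rintro ⟨x, y⟩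
  rw [ContinuousAt, Metric.tendsto_nhds]
  intro ε hε
  filter_upwards [prod_mem_nhds (rhoBall_mem_nhds hρ hA x (half_pos hε))
    (rhoBall_mem_nhds hρ hA y (half_pos hε))]
  rintro ⟨x', y'⟩ ⟨hx : ρ x x' < ε / 2, hy : ρ y y' < ε / 2⟩
  rw [Real.dist_eq, abs_lt]
  constructor <;>
    linarith [hρ.triangle x x' y, hρ.triangle x' y' y, hρ.triangle x' x y', hρ.triangle x y y',
      hρ.symm x x', hρ.symm y y']

lemma continuous_costEps (hρ : IsMetric ρ) (hA : AssumptionA ρ) (ε : ℝ) :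
    Continuous fun p : Ω × Ω => costEps ρ ε p.1 p.2 := by
  have := continuous_rho hρ hA
  unfold costEps
  fun_prop

lemma costEps_nonneg (hρ : IsMetric ρ) {ε : ℝ} (hε : 0 ≤ ε) (x y : Ω) : 0 ≤ costEps ρ ε x y :=
  add_nonneg (hρ.nonneg x y) (by positivity)

end Metric

/-! ### Monotonicity of the support of an optimal plan -/

section Optimal

variable {X : Type*} [MeasurableSpace X] [TopologicalSpace X] [OpensMeasurableSpace (X × X)]

/-- If the inequality failed at two points `p`, `q` of the support, it would fail by a uniform
amount on the product of a neighbourhood of `p` and one of `q`. Exchanging the second coordinates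
on a part of the mass near `p` and `q` would then give a strictly cheaper plan with the same
marginals. The exchange is the image of a product measure on `(X × X) × (X × X)`, which makes the
equality of the marginals evident. -/
lemma support_monotone_of_optimal {c : X × X → ℝ} (hc : Continuous c) (hc0 : ∀ p, 0 ≤ c p)
    (π : Measure (X × X)) [IsProbabilityMeasure π]
    (hfin : ∫⁻ p, ENNReal.ofReal (c p) ∂π ≠ ∞)
    (hopt : ∀ π' : Measure (X × X), IsProbabilityMeasure π' →
      π'.map Prod.fst = π.map Prod.fst → π'.map Prod.snd = π.map Prod.snd →
      ∫⁻ p, ENNReal.ofReal (c p) ∂π ≤ ∫⁻ p, ENNReal.ofReal (c p) ∂π')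
    {p q : X × X} (hp : p ∈ π.support) (hq : q ∈ π.support) :
    c p + c q ≤ c (p.1, q.2) + c (q.1, p.2) := by
  by_contra! hlt
  obtain ⟨η, hη0, hη⟩ : ∃ η : ℝ, 0 < η ∧ c (p.1, q.2) + c (q.1, p.2) + η < c p + c q :=
    ⟨(c p + c q - (c (p.1, q.2) + c (q.1, p.2))) / 2, by linarith, by linarith⟩
  let sw₁ : (X × X) × (X × X) → X × X := fun z => (z.1.1, z.2.2)
  let sw₂ : (X × X) × (X × X) → X × X := fun z => (z.2.1, z.1.2)
  have hcsw₁ : Continuous sw₁ := by fun_prop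
  have hcsw₂ : Continuous sw₂ := by fun_prop
  have hsw₁ : Measurable sw₁ := by fun_prop
  have hsw₂ : Measurable sw₂ := by fun_prop
  obtain ⟨P, Q, hPo, hQo, hpP, hqQ, hPQ⟩ := isOpen_prod_iff.1
    (isOpen_lt (f := fun z : (X × X) × (X × X) => c (sw₁ z) + c (sw₂ z) + η)
      (g := fun z => c z.1 + c z.2) (by fun_prop) (by fun_prop)) p q hη
  have hmP := (Measure.mem_support_iff_forall p).1 hp P (hPo.mem_nhds hpP)
  have hmQ := (Measure.mem_support_iff_forall q).1 hq Q (hQo.mem_nhds hqQ)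
  set β : Measure ((X × X) × (X × X)) := (π.restrict P).prod (π.restrict Q) with hβ
  have hβfst : β.map Prod.fst = π Q • π.restrict P := by
    rw [hβ, Measure.map_fst_prod, Measure.restrict_apply_univ]
  have hβsnd : β.map Prod.snd = π P • π.restrict Q := by
    rw [hβ, Measure.map_snd_prod, Measure.restrict_apply_univ]
  set σ : Measure (X × X) := (2⁻¹ : ℝ≥0∞) • (β.map Prod.fst + β.map Prod.snd) with hσ
  set σ' : Measure (X × X) := (2⁻¹ : ℝ≥0∞) • (β.map sw₁ + β.map sw₂) with hσ'
  have hσπ : σ ≤ π := by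
    have h1 : π Q • π.restrict P ≤ π := by
      intro s
      rw [Measure.smul_apply, smul_eq_mul]
      exact (mul_le_mul' prob_le_one (Measure.restrict_apply_le P s)).trans (one_mul _).le
    have h2 : π P • π.restrict Q ≤ π := by
      intro s
      rw [Measure.smul_apply, smul_eq_mul]
      exact (mul_le_mul' prob_le_one (Measure.restrict_apply_le Q s)).trans (one_mul _).le
    intro s
    rw [hσ, hβfst, hβsnd, Measure.smul_apply, Measure.add_apply, smul_eq_mul]
    calc 2⁻¹ * ((π Q • π.restrict P) s + (π P • π.restrict Q) s) ≤ 2⁻¹ * (π s + π s) := by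
          gcongr 2⁻¹ * (?_ + ?_)
          exacts [h1 s, h2 s]
      _ = π s := by
          rw [← two_mul, ← mul_assoc, ENNReal.inv_mul_cancel (by simp) (by simp), one_mul]
  have : IsFiniteMeasure σ := isFiniteMeasure_of_le π hσπ
  have hdec : π - σ + σ = π := Measure.sub_add_cancel_of_le hσπ
  have hfst : σ'.map Prod.fst = σ.map Prod.fst := by
    simp only [hσ, hσ', Measure.map_smul, Measure.map_add _ _ measurable_fst]
    rw [Measure.map_map measurable_fst hsw₁, Measure.map_map measurable_fst hsw₂,
      Measure.map_map measurable_fst measurable_fst, Measure.map_map measurable_fst measurable_snd]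
    rfl
  have hsnd : σ'.map Prod.snd = σ.map Prod.snd := by
    simp only [hσ, hσ', Measure.map_smul, Measure.map_add _ _ measurable_snd]
    rw [Measure.map_map measurable_snd hsw₁, Measure.map_map measurable_snd hsw₂,
      Measure.map_map measurable_snd measurable_fst, Measure.map_map measurable_snd measurable_snd,
      add_comm]
    rfl
  have hfst' : (π - σ + σ').map Prod.fst = π.map Prod.fst := by
    rw [Measure.map_add _ _ measurable_fst, hfst, ← Measure.map_add _ _ measurable_fst, hdec]
  have hsnd' : (π - σ + σ').map Prod.snd = π.map Prod.snd := by
    rw [Measure.map_add _ _ measurable_snd, hsnd, ← Measure.map_add _ _ measurable_snd, hdec]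
  have hprob : IsProbabilityMeasure (π - σ + σ') := by
    refine ⟨?_⟩
    have h := congrArg (fun m : Measure X => m univ) hfst'
    simpa [Measure.map_apply measurable_fst MeasurableSet.univ] using h
  have hle := hopt _ hprob hfst' hsnd'
  set F : X × X → ℝ≥0∞ := fun p => ENNReal.ofReal (c p) with hF
  have hFm : Measurable F := (ENNReal.continuous_ofReal.comp hc).measurable
  have hcost : ∫⁻ p, F p ∂σ = 2⁻¹ * ∫⁻ z, (F z.1 + F z.2) ∂β := by
    rw [hσ, lintegral_smul_measure, lintegral_add_measure, lintegral_map hFm measurable_fst,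
      lintegral_map hFm measurable_snd, smul_eq_mul,
      ← lintegral_add_left (by fun_prop)]
  have hcost' : ∫⁻ p, F p ∂σ' = 2⁻¹ * ∫⁻ z, (F (sw₁ z) + F (sw₂ z)) ∂β := by
    rw [hσ', lintegral_smul_measure, lintegral_add_measure, lintegral_map hFm hsw₁,
      lintegral_map hFm hsw₂, smul_eq_mul,
      ← lintegral_add_left (by fun_prop)]
  have hβPQ : ∀ᵐ z ∂β, z ∈ P ×ˢ Q := by
    rw [hβ, Measure.prod_restrict]
    exact ae_restrict_mem (hPo.measurableSet.prod hQo.measurableSet)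
  have hgain : ∫⁻ z, (F (sw₁ z) + F (sw₂ z)) ∂β + ENNReal.ofReal η * (π P * π Q)
      ≤ ∫⁻ z, (F z.1 + F z.2) ∂β := by
    have hβu : β univ = π P * π Q := by
      rw [hβ, Measure.prod_restrict, Measure.restrict_apply_univ, Measure.prod_prod]
    rw [← hβu, ← lintegral_const, ← lintegral_add_right _ measurable_const]
    refine lintegral_mono_ae (hβPQ.mono fun z hz => ?_)
    have hz' : c (sw₁ z) + c (sw₂ z) + η < c z.1 + c z.2 := hPQ hz
    simp only [hF]
    rw [← ENNReal.ofReal_add (hc0 _) (hc0 _), ← ENNReal.ofReal_add (hc0 _) (hc0 _),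
      ← ENNReal.ofReal_add (add_nonneg (hc0 _) (hc0 _)) hη0.le]
    exact ENNReal.ofReal_le_ofReal hz'.le
  set g : ℝ≥0∞ := 2⁻¹ * (ENNReal.ofReal η * (π P * π Q)) with hg
  have hg0 : g ≠ 0 := by
    simp [hg, hη0, hmP.ne', hmQ.ne']
  have hσσ' : ∫⁻ p, F p ∂σ' + g ≤ ∫⁻ p, F p ∂σ := by
    rw [hcost, hcost', hg, ← mul_add]
    gcongr
  have htot : ∫⁻ p, F p ∂π + g ≤ ∫⁻ p, F p ∂π := by
    calc ∫⁻ p, F p ∂π + g ≤ ∫⁻ p, F p ∂(π - σ + σ') + g := by gcongr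
      _ = ∫⁻ p, F p ∂(π - σ) + (∫⁻ p, F p ∂σ' + g) := by rw [lintegral_add_measure, add_assoc]
      _ ≤ ∫⁻ p, F p ∂(π - σ) + ∫⁻ p, F p ∂σ := by gcongr
      _ = ∫⁻ p, F p ∂π := by rw [← lintegral_add_measure, hdec]
  exact absurd htot (not_le.2 (ENNReal.lt_add_right hfin hg0))

end Optimal

/-! ### Minimizers of the penalized functional -/

section Minimizers

variable {n : ℕ} {Ω : Set (Eucl n)} {ρ : Ω → Ω → ℝ}

lemma lintegral_ofReal_lt_top_of_isCompact_support {X : Type*} [TopologicalSpace X]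
    [MeasurableSpace X] [HereditarilyLindelofSpace X] {μ : Measure X}
    [IsFiniteMeasure μ] (hμ : IsCompact μ.support) {f : X → ℝ} (hf : Continuous f) :
    ∫⁻ z, ENNReal.ofReal (f z) ∂μ < ∞ := by
  obtain ⟨M, hM⟩ := (hμ.image hf).bddAbove
  calc ∫⁻ z, ENNReal.ofReal (f z) ∂μ ≤ ∫⁻ _, ENNReal.ofReal M ∂μ := by
        refine lintegral_mono_ae ?_
        filter_upwards [Measure.support_mem_ae (μ := μ)] with z hz
        exact ENNReal.ofReal_le_ofReal (hM (mem_image_of_mem _ hz))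
    _ < ∞ := by
        rw [lintegral_const]
        exact ENNReal.mul_lt_top ENNReal.ofReal_lt_top (measure_lt_top _ _)

/-- The competitor sends all the mass to one point: it has finite cost, as both measures have
compact support, and its second marginal has a single atom. -/
lemma exists_funcEps_lt_top (hρ : IsMetric ρ) (hA : AssumptionA ρ) (μ₁ μ₂ : ProbabilityMeasure Ω)
    (hμ₁ : IsCompact (μ₁ : Measure Ω).support) (hμ₂ : IsCompact (μ₂ : Measure Ω).support)
    (d ε : ℝ) : ∃ π : ProbabilityMeasure (Ω × Ω), (π : Measure (Ω × Ω)).map Prod.fst = μ₁ ∧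
      funcEps ρ (μ₂ : Measure Ω) d ε π < ∞ := by
  obtain ⟨y⟩ : Nonempty Ω := nonempty_of_isProbabilityMeasure (μ₁ : Measure Ω)
  refine ⟨⟨(μ₁ : Measure Ω).prod (Measure.dirac y), inferInstance⟩, by simp, ?_⟩
  have hsnd : (((μ₁ : Measure Ω).prod (Measure.dirac y)).map Prod.snd) = Measure.dirac y := by simp
  simp only [funcEps, ProbabilityMeasure.coe_mk, hsnd]
  have hW : W1 ρ (Measure.dirac y) (μ₂ : Measure Ω) < ∞ := by
    refine lt_of_le_of_lt (iInf₂_le ⟨(Measure.dirac y).prod (μ₂ : Measure Ω), inferInstance⟩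
      ⟨by simp, by simp⟩) ?_
    simp only [ProbabilityMeasure.coe_mk]
    rw [lintegral_prod _
      (continuous_rho hρ hA).measurable.ennreal_ofReal.aemeasurable, lintegral_dirac]
    exact lintegral_ofReal_lt_top_of_isCompact_support hμ₂
      ((continuous_rho hρ hA).comp (Continuous.prodMk_right y))
  have hI : ∫⁻ p, ENNReal.ofReal (costEps ρ ε p.1 p.2) ∂(μ₁ : Measure Ω).prod (Measure.dirac y)
      < ∞ := by
    rw [lintegral_prod _
      (continuous_costEps hρ hA ε).measurable.ennreal_ofReal.aemeasurable]
    simp only [lintegral_dirac]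
    exact lintegral_ofReal_lt_top_of_isCompact_support hμ₁
      ((continuous_costEps hρ hA ε).comp (Continuous.prodMk_left y))
  have hS : (Measure.dirac y).support.Finite := by
    refine (finite_singleton y).subset
      (Measure.support_subset_of_isClosed isClosed_singleton ?_)
    rw [mem_ae_dirac_iff (MeasurableSet.singleton y)]
    rfl
  refine ENNReal.add_lt_top.2 ⟨ENNReal.add_lt_top.2 ⟨ENNReal.mul_lt_top ENNReal.ofReal_lt_top hW,
    hI⟩, ENNReal.mul_lt_top ENNReal.ofReal_lt_top ?_⟩
  rw [← hS.cast_ncard_eq]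
  exact ENNReal.natCast_lt_top _

/-- A minimizer has a finitely supported second marginal, and, as it is optimal among the plans
with its own marginals, its support is monotone for the cost `c_ε`. -/
lemma minimizersEps_spec (hρ : IsMetric ρ) (hA : AssumptionA ρ) (μ₁ μ₂ : ProbabilityMeasure Ω)
    (hμ₁ : IsCompact (μ₁ : Measure Ω).support) (hμ₂ : IsCompact (μ₂ : Measure Ω).support)
    {d ε : ℝ} (hε : 0 < ε) {π : ProbabilityMeasure (Ω × Ω)}
    (hπ : π ∈ minimizersEps ρ (μ₁ : Measure Ω) (μ₂ : Measure Ω) d ε) :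
    ((π : Measure (Ω × Ω)).map Prod.snd).support.Finite ∧
      ∀ p ∈ (π : Measure (Ω × Ω)).support, ∀ q ∈ (π : Measure (Ω × Ω)).support,
        costEps ρ ε p.1 p.2 + costEps ρ ε q.1 q.2
          ≤ costEps ρ ε p.1 q.2 + costEps ρ ε q.1 p.2 := by
  obtain ⟨hπ1, hmin⟩ := hπ
  obtain ⟨π₀, h01, h0⟩ := exists_funcEps_lt_top hρ hA μ₁ μ₂ hμ₁ hμ₂ d ε
  have hlt : funcEps ρ (μ₂ : Measure Ω) d ε π < ∞ := (hmin π₀ h01).trans_lt h0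
  simp only [funcEps, ENNReal.add_lt_top] at hlt
  obtain ⟨⟨hW, hI⟩, hS⟩ := hlt
  constructor
  · by_contra hinf
    rw [Set.Infinite.encard_eq hinf] at hS
    have : ENNReal.ofReal (ε ^ (3 * d + 2)) ≠ 0 := by
      simpa using Real.rpow_pos_of_pos hε _
    simp [ENNReal.mul_top this] at hS
  · intro p hp q hq
    refine support_monotone_of_optimal (c := fun p : Ω × Ω => costEps ρ ε p.1 p.2)
      (continuous_costEps hρ hA ε) (fun p => costEps_nonneg hρ hε.le p.1 p.2)
      (π : Measure (Ω × Ω)) hI.ne ?_ hp hq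
    intro π' hπ' hfst hsnd
    have h := hmin ⟨π', hπ'⟩ (by simpa [hfst] using hπ1)
    simp only [funcEps, ProbabilityMeasure.coe_mk, hsnd] at h
    rw [ENNReal.add_le_add_iff_right hS.ne] at h
    exact (ENNReal.add_le_add_iff_left hW.ne).1 h

end Minimizers

/-! ### Interpolation along a plan with finitely many targets -/

section Interpolation

variable {n : ℕ} {Ω : Set (Eucl n)} {ρ : Ω → Ω → ℝ}

/-- The point `(1 - t) x + t y` of the segment `[x, y]`, as a function of the pair `(x, y)`. -/
def interp (t : ℝ) (p : Ω × Ω) : Eucl n := (1 - t) • (p.1 : Eucl n) + t • (p.2 : Eucl n)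

lemma continuous_interp (t : ℝ) : Continuous (interp t : Ω × Ω → Eucl n) := by
  unfold interp
  fun_prop

/-- If two segments cross at the same time `t`, then exchanging their targets does not increase
the sum of the `ρ`-costs, by the triangle inequality at the crossing point. Monotonicity therefore
forces `|x - y|² + |x' - y'|² ≤ |x - y'|² + |x' - y|²`, that is `⟪x - x', y - y'⟫ ≥ 0`, whereas
`(1 - t) (x - x') = -t (y - y')`. -/
lemma interp_injOn_of_monotone (hΩ : Convex ℝ Ω) (hρ : IsMetric ρ) (hA : AssumptionA ρ)
    {ε t : ℝ} (hε : 0 < ε) (ht : t ∈ Ioo (0 : ℝ) 1) {G : Set (Ω × Ω)}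
    (hG : ∀ p ∈ G, ∀ q ∈ G, costEps ρ ε p.1 p.2 + costEps ρ ε q.1 q.2
      ≤ costEps ρ ε p.1 q.2 + costEps ρ ε q.1 p.2) :
    InjOn (interp t) G := by
  rintro ⟨x, y⟩ hp ⟨x', y'⟩ hq heq
  obtain ⟨ht0, ht1⟩ := ht
  have hseg : interp t (x, y) ∈ segment ℝ (x : Eucl n) (y : Eucl n) :=
    ⟨1 - t, t, by linarith, ht0.le, by ring, rfl⟩
  have hseg' : interp t (x, y) ∈ segment ℝ (x' : Eucl n) (y' : Eucl n) := by
    rw [heq]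
    exact ⟨1 - t, t, by linarith, ht0.le, by ring, rfl⟩
  have g1 := hA.segment_geodesic x y ⟨_, hΩ.segment_subset x.2 y.2 hseg⟩ hseg
  have g2 := hA.segment_geodesic x' y' ⟨_, hΩ.segment_subset x.2 y.2 hseg⟩ hseg'
  set z : Ω := ⟨_, hΩ.segment_subset x.2 y.2 hseg⟩
  have hmon := hG _ hp _ hq
  simp only [costEps] at hmon
  have hsq : ‖(x : Eucl n) - y‖ ^ 2 + ‖(x' : Eucl n) - y'‖ ^ 2
      ≤ ‖(x : Eucl n) - y'‖ ^ 2 + ‖(x' : Eucl n) - y‖ ^ 2 := by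
    have h1 := hρ.triangle x z y'
    have h2 := hρ.triangle x' z y
    refine le_of_mul_le_mul_left ?_ hε
    linarith
  set u : Eucl n := (x : Eucl n) - x' with hu
  set v : Eucl n := (y : Eucl n) - y' with hv
  have huv : (1 - t) • u + t • v = 0 := by
    have h : (1 - t) • (x : Eucl n) + t • (y : Eucl n)
        = (1 - t) • (x' : Eucl n) + t • (y' : Eucl n) := heq
    rw [hu, hv, smul_sub, smul_sub, ← sub_eq_zero.2 h]
    abel
  have hinner : 0 ≤ inner ℝ u v := by
    have e1 := norm_sub_sq_real (x : Eucl n) y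
    have e2 := norm_sub_sq_real (x' : Eucl n) y'
    have e3 := norm_sub_sq_real (x : Eucl n) y'
    have e4 := norm_sub_sq_real (x' : Eucl n) y
    rw [hu, hv, inner_sub_left, inner_sub_right, inner_sub_right]
    linarith
  have hzero : (1 - t) * inner ℝ u v + t * ‖v‖ ^ 2 = 0 := by
    have h := congrArg (fun w : Eucl n => inner ℝ w v) huv
    simpa [inner_add_left, real_inner_smul_left, real_inner_self_eq_norm_sq] using h
  have hv0 : v = 0 := by
    have h1 : 0 ≤ (1 - t) * inner ℝ u v := mul_nonneg (by linarith) hinner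
    have h2 : t * ‖v‖ ^ 2 ≤ 0 := by linarith
    have h3 : ‖v‖ ^ 2 ≤ 0 := nonpos_of_mul_nonpos_right h2 ht0
    have h4 : ‖v‖ = 0 := by
      have := sq_nonneg ‖v‖
      exact pow_eq_zero_iff (two_ne_zero) |>.1 (le_antisymm h3 this)
    exact norm_eq_zero.1 h4
  have hu0 : u = 0 := by
    rw [hv0, smul_zero, add_zero] at huv
    exact (smul_eq_zero.1 huv).resolve_left (by linarith)
  exact Prod.ext (Subtype.ext (sub_eq_zero.1 hu0)) (Subtype.ext (sub_eq_zero.1 hv0))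

lemma measurableSet_fst_image {X : Type*} [MeasurableSpace X] {G : Set (X × X)}
    (hGm : MeasurableSet G) {F : Set X} (hF : F.Finite) (hGF : ∀ p ∈ G, p.2 ∈ F) :
    MeasurableSet (Prod.fst '' G) := by
  have hfst : Prod.fst '' G = ⋃ y ∈ F, {x | (x, y) ∈ G} := by
    ext x
    simp only [mem_image, Prod.exists, exists_and_right, exists_eq_right, mem_iUnion,
      exists_prop, mem_ofPred_eq]
    exact ⟨fun ⟨y, hy⟩ => ⟨y, hGF _ hy, hy⟩, fun ⟨y, _, hy⟩ => ⟨y, hy⟩⟩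
  rw [hfst]
  exact hF.measurableSet_biUnion fun y _ => measurable_prodMk_right hGm

lemma leb_apply (hΩ : MeasurableSet Ω) (S : Set Ω) : leb Ω S = volume (Subtype.val '' S) :=
  comap_subtype_coe_apply hΩ _ _

/-- Interpolating towards a finite set of targets is a homothety of ratio `1 - t` on each set of
points with a common target. If the images of these sets are disjoint, the volume shrinks at most
by the factor `(1 - t) ^ n`. -/
lemma leb_fst_image_le_volume_interp_image (hΩ : MeasurableSet Ω) {t : ℝ}
    (ht : t ∈ Ioo (0 : ℝ) 1) {G : Set (Ω × Ω)} (hGm : MeasurableSet G) {F : Set Ω}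
    (hF : F.Finite) (hGF : ∀ p ∈ G, p.2 ∈ F) (hinj : InjOn (interp t) G) :
    ENNReal.ofReal ((1 - t) ^ n) * leb Ω (Prod.fst '' G) ≤ volume (interp t '' G) := by
  set S : Ω → Set Ω := fun y => {x | (x, y) ∈ G} with hS
  have hSm : ∀ y, MeasurableSet (S y) := fun y => measurable_prodMk_right hGm
  have himg : ∀ y, (fun x => interp t (x, y)) '' S y
      = AffineMap.homothety (y : Eucl n) (1 - t) '' (Subtype.val '' S y) := by
    intro y
    rw [image_image]
    refine image_congr fun x _ => ?_
    simp only [interp, AffineMap.homothety_apply, vsub_eq_sub, vadd_eq_add]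
    module
  have hvol : ∀ y, volume ((fun x => interp t (x, y)) '' S y)
      = ENNReal.ofReal ((1 - t) ^ n) * leb Ω (S y) := by
    intro y
    rw [himg, Measure.addHaar_image_homothety, leb_apply hΩ, finrank_euclideanSpace_fin,
      abs_of_nonneg (pow_nonneg (by linarith [ht.2]) n)]
  have hfst : Prod.fst '' G = ⋃ y ∈ hF.toFinset, S y := by
    ext x
    simp only [mem_image, Prod.exists, exists_and_right, exists_eq_right, mem_iUnion,
      Finite.mem_toFinset, exists_prop, hS, mem_ofPred_eq]
    exact ⟨fun ⟨y, hy⟩ => ⟨y, hGF _ hy, hy⟩, fun ⟨y, _, hy⟩ => ⟨y, hy⟩⟩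
  have hsub : (⋃ y ∈ hF.toFinset, (fun x => interp t (x, y)) '' S y) ⊆ interp t '' G := by
    refine iUnion₂_subset fun y _ => ?_
    rintro _ ⟨x, hx, rfl⟩
    exact ⟨(x, y), hx, rfl⟩
  have hdisj : (hF.toFinset : Set Ω).PairwiseDisjoint
      fun y => (fun x => interp t (x, y)) '' S y := by
    intro y _ y' _ hyy'
    refine Set.disjoint_left.2 ?_
    rintro _ ⟨x, hx, rfl⟩ ⟨x', hx', heq⟩
    exact hyy' (Prod.ext_iff.1 (hinj hx' hx heq)).2.symm
  have hmeas : ∀ y ∈ hF.toFinset, MeasurableSet ((fun x => interp t (x, y)) '' S y) := by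
    intro y _
    rw [himg]
    have hcont : Continuous (AffineMap.homothety (y : Eucl n) (1 - t)) :=
      AffineMap.homothety_continuous _ _
    have hinj : Function.Injective (AffineMap.homothety (y : Eucl n) (1 - t)) := by
      intro a b hab
      have h : (1 - t) • (a - b) = 0 := by
        simp only [AffineMap.homothety_apply, vsub_eq_sub, vadd_eq_add] at hab
        rw [← sub_eq_zero.2 hab]
        module
      exact sub_eq_zero.1 ((smul_eq_zero.1 h).resolve_left (by linarith [ht.2]))
    exact (hcont.measurableEmbedding hinj).measurableSet_image.2
      ((MeasurableEmbedding.subtype_coe hΩ).measurableSet_image.2 (hSm y))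
  calc ENNReal.ofReal ((1 - t) ^ n) * leb Ω (Prod.fst '' G)
      ≤ ENNReal.ofReal ((1 - t) ^ n) * ∑ y ∈ hF.toFinset, leb Ω (S y) := by
        rw [hfst]
        gcongr
        exact measure_biUnion_finset_le _ _
    _ = volume (⋃ y ∈ hF.toFinset, (fun x => interp t (x, y)) '' S y) := by
        rw [measure_biUnion_finset hdisj hmeas, Finset.mul_sum]
        exact Finset.sum_congr rfl fun y _ => (hvol y).symm
    _ ≤ volume (interp t '' G) := measure_mono hsub

end Interpolation

/-! ### Balls of a convex set, and densities -/

section Density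

variable {n : ℕ} {Ω : Set (Eucl n)}

lemma image_val_ball (x : Ω) (s : ℝ) :
    Subtype.val '' Metric.ball x s = Metric.ball (x : Eucl n) s ∩ Ω := by
  ext z
  simp only [mem_image, Metric.mem_ball, Subtype.exists, mem_inter_iff]
  exact ⟨fun ⟨a, ha, h1, h2⟩ => h2 ▸ ⟨h1, ha⟩, fun ⟨h1, h2⟩ => ⟨z, h2, h1, rfl⟩⟩

lemma leb_ball_le_volume (hΩ : MeasurableSet Ω) (x : Ω) (s : ℝ) :
    leb Ω (Metric.ball x s) ≤ volume (Metric.ball (x : Eucl n) s) := by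
  rw [leb_apply hΩ, image_val_ball]
  exact measure_mono inter_subset_left

/-- The homothety of centre `x` and ratio `s` maps a ball contained in `Ω` into `Ω`, so that `Ω`
fills a fixed proportion of the small balls around its point `x`. -/
lemma exists_volume_ball_le_leb_ball (hΩ : MeasurableSet Ω) (hconv : Convex ℝ Ω)
    (hint : (interior Ω).Nonempty) (x : Ω) :
    ∃ κ : ℝ, 0 < κ ∧ ∀ᶠ s in 𝓝[>] (0 : ℝ),
      ENNReal.ofReal κ * volume (Metric.ball (x : Eucl n) s) ≤ leb Ω (Metric.ball x s) := by
  obtain ⟨z, hz⟩ := hint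
  obtain ⟨r, hr, hball⟩ := Metric.isOpen_iff.1 isOpen_interior z hz
  have hball' : Metric.ball z r ⊆ Ω := hball.trans interior_subset
  set R : ℝ := ‖z - x‖ + r with hR
  have hR0 : 0 < R := by positivity
  refine ⟨(r / R) ^ n, by positivity, ?_⟩
  filter_upwards [Ioo_mem_nhdsGT hR0] with s hs
  obtain ⟨hs0, hsR⟩ := hs
  have hsub : AffineMap.homothety (x : Eucl n) (s / R) '' Metric.ball z r
      ⊆ Metric.ball (x : Eucl n) s ∩ Ω := by
    rintro _ ⟨w, hw, rfl⟩
    have hw' : ‖w - z‖ < r := by rwa [← dist_eq_norm]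
    constructor
    · rw [Metric.mem_ball, dist_eq_norm, AffineMap.homothety_apply, vsub_eq_sub, vadd_eq_add,
        add_sub_cancel_right, norm_smul, Real.norm_of_nonneg (by positivity)]
      have h : ‖w - x‖ < R := by
        have := norm_add_le (w - z) (z - (x : Eucl n))
        rw [sub_add_sub_cancel] at this
        linarith
      calc s / R * ‖w - (x : Eucl n)‖ < s / R * R := by gcongr
        _ = s := by field_simp
    · rw [AffineMap.homothety_eq_lineMap]
      exact hconv.lineMap_mem x.2 (hball' hw)
        ⟨by positivity, (div_le_one hR0).2 hsR.le⟩
  rw [leb_apply hΩ, image_val_ball]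
  refine le_trans (le_of_eq ?_) (measure_mono hsub)
  rw [Measure.addHaar_image_homothety, Measure.addHaar_ball_of_pos _ _ hs0,
    Measure.addHaar_ball_of_pos _ _ hr, finrank_euclideanSpace_fin, abs_of_pos (by positivity),
    ← mul_assoc, ← mul_assoc, ← ENNReal.ofReal_mul (by positivity),
    ← ENNReal.ofReal_mul (by positivity)]
  congr 2
  rw [← mul_pow, ← mul_pow]
  congr 1
  ring

lemma leb_sphere (hΩ : MeasurableSet Ω) (x : Ω) {s : ℝ} (hs : s ≠ 0) :
    leb Ω (Metric.sphere x s) = 0 := by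
  rw [leb_apply hΩ]
  refine measure_mono_null ?_ (Measure.addHaar_sphere_of_ne_zero volume (x : Eucl n) hs)
  rintro _ ⟨z, hz, rfl⟩
  exact hz

lemma map_val_leb (hΩ : MeasurableSet Ω) :
    (leb Ω).map Subtype.val = (volume : Measure (Eucl n)).restrict Ω :=
  map_comap_subtype_coe hΩ volume

/-- The density of an absolutely continuous measure is a version of its Radon–Nikodym derivative,
by the Besicovitch differentiation theorem in `ℝⁿ`. -/
lemma withDensity_density (hΩ : MeasurableSet Ω) (l : Measure Ω) [IsFiniteMeasure l]
    (hl : l ≪ leb Ω) :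
    AEMeasurable (density l) (leb Ω) ∧ (leb Ω).withDensity (density l) = l := by
  have hemb : MeasurableEmbedding (Subtype.val : Ω → Eucl n) := MeasurableEmbedding.subtype_coe hΩ
  set l' : Measure (Eucl n) := l.map Subtype.val with hl'
  set m' : Measure (Eucl n) := (leb Ω).map Subtype.val with hm'
  have : IsLocallyFiniteMeasure m' := by rw [hm', map_val_leb hΩ]; infer_instance
  have : SigmaFinite m' := by rw [hm', map_val_leb hΩ]; infer_instance
  have hac : l' ≪ m' := hl.map measurable_subtype_coe
  have hball : ∀ (k : Measure Ω), k ≪ leb Ω → ∀ (x : Ω) (s : ℝ), 0 < s →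
      k.map Subtype.val (Metric.closedBall (x : Eucl n) s) = k (Metric.ball x s) := by
    intro k hk x s hs
    rw [hemb.map_apply]
    have h : k (Metric.sphere x s) = 0 := hk (leb_sphere hΩ x hs.ne')
    change k (Metric.closedBall x s) = _
    rw [← Metric.ball_union_sphere]
    exact le_antisymm ((measure_union_le _ _).trans (by rw [h, add_zero]))
      (measure_mono subset_union_left)
  have hae : ∀ᵐ x ∂(leb Ω), density l x = l'.rnDeriv m' x := by
    have h := Besicovitch.ae_tendsto_rnDeriv l' m'
    rw [hm', hemb.ae_map_iff] at h
    filter_upwards [h] with x hx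
    refine Tendsto.limsup_eq (hx.congr' ?_)
    filter_upwards [self_mem_nhdsWithin] with s hs
    rw [hball l hl x s hs, hball _ Measure.AbsolutelyContinuous.rfl x s hs]
  have hmeas : Measurable fun x : Ω => l'.rnDeriv m' x :=
    (Measure.measurable_rnDeriv l' m').comp measurable_subtype_coe
  refine ⟨⟨_, hmeas, hae⟩, ?_⟩
  rw [withDensity_congr_ae hae]
  ext S hS
  rw [withDensity_apply _ hS]
  have hS' : Subtype.val ⁻¹' (Subtype.val '' S) = S := preimage_image_eq S Subtype.val_injective
  calc ∫⁻ x in S, l'.rnDeriv m' x ∂leb Ω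
      = ∫⁻ z in Subtype.val '' S, l'.rnDeriv m' z ∂m' := by
        rw [hm', hemb.restrict_map, hemb.lintegral_map, hS']
    _ = l' (Subtype.val '' S) := by
        rw [← withDensity_apply _ (hemb.measurableSet_image.2 hS),
          Measure.withDensity_rnDeriv_eq _ _ hac]
    _ = l S := by rw [hl', hemb.map_apply, hS']

lemma density_mono {l k : Measure Ω} (h : l ≤ k) (x : Ω) : density l x ≤ density k x :=
  limsup_le_limsup (Eventually.of_forall fun s => ENNReal.div_le_div_right (h _) _)

/-- Near a Lebesgue point `x` of the density of `l`, the mass of a subset of a small ball is at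
most about `density l x` times its volume. -/
lemma eventually_measure_le (hΩ : MeasurableSet Ω) (l : Measure Ω) [IsFiniteMeasure l]
    (hl : l ≪ leb Ω) {x : Ω} (hx : IsLebesguePoint (density l) x) {e : ℝ≥0∞} (he : 0 < e)
    (he' : e ≠ ∞) :
    ∀ᶠ s in 𝓝[>] (0 : ℝ), ∀ S ⊆ Metric.ball x s, MeasurableSet S →
      l S ≤ density l x * leb Ω S + e * leb Ω (Metric.ball x s) := by
  obtain ⟨hmeas, hwd⟩ := withDensity_density hΩ l hl
  filter_upwards [hx.eventually_le_const he] with s hs S hSs hS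
  have hfin : leb Ω (Metric.ball x s) ≠ ∞ :=
    ((leb_ball_le_volume hΩ x s).trans_lt measure_ball_lt_top).ne
  calc l S = ∫⁻ z in S, density l z ∂leb Ω := by rw [← withDensity_apply _ hS, hwd]
    _ ≤ ∫⁻ z in S, (density l x + (density l z - density l x)) ∂leb Ω :=
        lintegral_mono fun z => le_add_tsub
    _ = density l x * leb Ω S + ∫⁻ z in S, (density l z - density l x) ∂leb Ω := by
        rw [lintegral_add_left measurable_const, setLIntegral_const]
    _ ≤ density l x * leb Ω S + ∫⁻ z in Metric.ball x s,
          ((density l z - density l x) + (density l x - density l z)) ∂leb Ω := by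
        refine add_le_add_right ?_ _
        exact (lintegral_mono_set hSs).trans (lintegral_mono fun z => le_self_add)
    _ ≤ density l x * leb Ω S + e * leb Ω (Metric.ball x s) := by
        gcongr
        exact (ENNReal.div_le_iff_le_mul (.inr he') (.inl hfin)).1 hs

/-- Near a Lebesgue point `x` of the density of `l`, the mass of a small ball is at least about
`density l x` times its volume. -/
lemma eventually_le_measure_ball (hΩ : MeasurableSet Ω) (l : Measure Ω) [IsFiniteMeasure l]
    (hl : l ≪ leb Ω) {x : Ω} (hx : IsLebesguePoint (density l) x) {e : ℝ≥0∞} (he : 0 < e)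
    (he' : e ≠ ∞) :
    ∀ᶠ s in 𝓝[>] (0 : ℝ), density l x * leb Ω (Metric.ball x s)
      ≤ l (Metric.ball x s) + e * leb Ω (Metric.ball x s) := by
  obtain ⟨hmeas, hwd⟩ := withDensity_density hΩ l hl
  filter_upwards [hx.eventually_le_const he] with s hs
  have hfin : leb Ω (Metric.ball x s) ≠ ∞ :=
    ((leb_ball_le_volume hΩ x s).trans_lt measure_ball_lt_top).ne
  calc density l x * leb Ω (Metric.ball x s)
      = ∫⁻ z in Metric.ball x s, density l x ∂leb Ω := by rw [setLIntegral_const]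
    _ ≤ ∫⁻ z in Metric.ball x s, (density l z + ((density l z - density l x)
          + (density l x - density l z))) ∂leb Ω :=
        lintegral_mono fun z => le_add_tsub.trans (by gcongr; exact le_add_self)
    _ = l (Metric.ball x s) + ∫⁻ z in Metric.ball x s, ((density l z - density l x)
          + (density l x - density l z)) ∂leb Ω := by
        rw [lintegral_add_left' hmeas.restrict, 
          ← withDensity_apply _ Metric.isOpen_ball.measurableSet,
          hwd]
    _ ≤ l (Metric.ball x s) + e * leb Ω (Metric.ball x s) := by
        gcongr
        exact (ENNReal.div_le_iff_le_mul (.inr he') (.inl hfin)).1 hs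

end Density

/-! ### Cluster points of minimizers -/

section ClusterPoints

variable {n : ℕ} {Ω : Set (Eucl n)} {ρ : Ω → Ω → ℝ}

lemma map_fst_of_mem_setO2 {C : ℝ} {μ₁ μ₂ : ProbabilityMeasure Ω}
    {π : ProbabilityMeasure (Ω × Ω)}
    (hπ : π ∈ setO2 ρ C (μ₁ : Measure Ω) (μ₂ : Measure Ω)) :
    (π : Measure (Ω × Ω)).map Prod.fst = μ₁ := by
  obtain ⟨ε, p, _, _, hp, hcl⟩ := hπ
  have hcont : Continuous fun q : ProbabilityMeasure (Ω × Ω) =>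
      q.map (measurable_fst (α := Ω) (β := Ω)).aemeasurable :=
    ProbabilityMeasure.continuous_map continuous_fst
  have hclosed : IsClosed {q : ProbabilityMeasure (Ω × Ω) |
      q.map (measurable_fst (α := Ω) (β := Ω)).aemeasurable = μ₁} :=
    isClosed_eq hcont continuous_const
  have hmem : π ∈ {q : ProbabilityMeasure (Ω × Ω) |
      q.map (measurable_fst (α := Ω) (β := Ω)).aemeasurable = μ₁} := by
    by_contra hnot
    obtain ⟨k, hk⟩ := (mapClusterPt_iff_frequently.1 hcl _
      (hclosed.isOpen_compl.mem_nhds hnot)).exists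
    exact hk (Subtype.ext (hp k).1)
  exact congrArg Subtype.val hmem

/-- A limit plan inherits the volume estimate for the interpolation from the approximating
minimizers. Since nothing is known about the limit plan itself, the set `K` is replaced by an open
neighbourhood `U` whose interpolation has almost the same volume as that of `K`: some minimizer
gives `U` almost the mass that `π` gives to `K`, and `S` is the set of the starting points of the
part of its support that lies in `U`. -/
lemma exists_leb_lt_of_mem_setO2 (hΩm : MeasurableSet Ω) (hΩ : Convex ℝ Ω) (hρ : IsMetric ρ)
    (hA : AssumptionA ρ) {C : ℝ} {μ₁ μ₂ : ProbabilityMeasure Ω}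
    (hμ₁ : IsCompact (μ₁ : Measure Ω).support) (hμ₂ : IsCompact (μ₂ : Measure Ω).support)
    {π : ProbabilityMeasure (Ω × Ω)}
    (hπ : π ∈ setO2 ρ C (μ₁ : Measure Ω) (μ₂ : Measure Ω))
    {K : Set (Ω × Ω)} {B : Set Ω} (hB : IsOpen B) (hKB : ∀ p ∈ K, p.1 ∈ B)
    {t : ℝ} (ht : t ∈ Ioo (0 : ℝ) 1) {c A : ℝ≥0∞} (hc : c < (π : Measure (Ω × Ω)) K)
    (hV : volume (interp t '' K) < A) :
    ∃ S ⊆ B, MeasurableSet S ∧ c < (μ₁ : Measure Ω) S ∧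
      ENNReal.ofReal ((1 - t) ^ n) * leb Ω S < A := by
  obtain ⟨O, hKO, hO, hOA⟩ := Set.exists_isOpen_lt_of_lt _ _ hV
  set U : Set (Ω × Ω) := interp t ⁻¹' O ∩ Prod.fst ⁻¹' B with hU
  have hUo : IsOpen U := (hO.preimage (continuous_interp t)).inter (hB.preimage continuous_fst)
  have hKU : K ⊆ U := fun p hp => ⟨hKO (mem_image_of_mem _ hp), hKB p hp⟩
  obtain ⟨ε, p, hε, _, hp, hcl⟩ := hπ
  have hev : ∀ᶠ q : ProbabilityMeasure (Ω × Ω) in 𝓝 π, c < (q : Measure (Ω × Ω)) U :=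
    eventually_lt_of_lt_liminf ((hc.trans_le (measure_mono hKU)).trans_le
      (ProbabilityMeasure.le_liminf_measure_open_of_tendsto tendsto_id hUo))
  obtain ⟨k, hk⟩ := (mapClusterPt_iff_frequently.1 hcl _ hev).exists
  obtain ⟨hfin, hmon⟩ := minimizersEps_spec hρ hA μ₁ μ₂ hμ₁ hμ₂ (hε k) (hp k)
  set q : Measure (Ω × Ω) := (p k : Measure (Ω × Ω)) with hq
  set F : Set Ω := (q.map Prod.snd).support with hF
  set G : Set (Ω × Ω) := U ∩ (q.support ∩ Prod.snd ⁻¹' F) with hG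
  have hGm : MeasurableSet G := hUo.measurableSet.inter
    (Measure.isClosed_support.measurableSet.inter
      (measurable_snd Measure.isClosed_support.measurableSet))
  have hGF : ∀ z ∈ G, z.2 ∈ F := fun z hz => hz.2.2
  have hSm := measurableSet_fst_image hGm hfin hGF
  refine ⟨Prod.fst '' G, ?_, hSm, ?_, ?_⟩
  · rintro _ ⟨z, hz, rfl⟩
    exact hz.1.2
  · have hae : ∀ᵐ z ∂q, z ∈ q.support ∩ Prod.snd ⁻¹' F := by
      filter_upwards [Measure.support_mem_ae (μ := q), ae_of_ae_map measurable_snd.aemeasurable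
        (Measure.support_mem_ae (μ := q.map Prod.snd))] with z h1 h2
      exact ⟨h1, h2⟩
    rw [← (hp k).1, Measure.map_apply measurable_fst hSm]
    refine lt_of_lt_of_le (show c < q U from hk) (measure_mono_ae ?_)
    filter_upwards [hae] with z hz hzU
    exact ⟨z, ⟨hzU, hz⟩, rfl⟩
  · refine ((leb_fst_image_le_volume_interp_image hΩm ht hGm hfin hGF
      (interp_injOn_of_monotone hΩ hρ hA (hε k) ht fun a ha b hb =>
        hmon a ha.2.1 b hb.2.1)).trans (measure_mono ?_)).trans_lt hOA
    rintro _ ⟨z, hz, rfl⟩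
    exact hz.1.1

end ClusterPoints

end MongeMetric

/-! ### Volume of the transport set at density-regular points -/

open MongeMetric

theorem mainTheorem5 {n : ℕ} {Ω : Set (EuclideanSpace ℝ (Fin n))}
    (hΩ_bdd : Bornology.IsBounded Ω) (hΩ_conv : Convex ℝ Ω) (hΩ_Gδ : IsGδ Ω)
    (hΩ_int : (interior Ω).Nonempty)
    (ρ : Ω → Ω → ℝ) (hρ : MongeMetric.IsMetric ρ) (hA : MongeMetric.AssumptionA ρ)
    (μ₁ μ₂ : ProbabilityMeasure Ω)
    (hμ₁ : IsCompact (μ₁ : Measure Ω).support) (hμ₂ : IsCompact (μ₂ : Measure Ω).support)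
    (hac : (μ₁ : Measure Ω) ≪ MongeMetric.leb Ω)
    (C : ℝ) (hC : MongeMetric.IsDoublingConstant ρ (μ₂ : Measure Ω).support C)
    (π : ProbabilityMeasure (Ω × Ω))
    (hπ : π ∈ MongeMetric.setO2 ρ C (μ₁ : Measure Ω) (μ₂ : Measure Ω))
    (Γ : Set (Ω × Ω)) (hΓ : IsSigmaCompact Γ) (hπΓ : (π : Measure (Ω × Ω)) Γᶜ = 0)
    (x y : Ω) (hxy : (x, y) ∈ MongeMetric.densityRegular (π : Measure (Ω × Ω)) Γ) (hne : x ≠ y)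
    (r : ℝ) (hr : 0 < r) :
    0 < liminf (fun δ : ℝ =>
        volume (MongeMetric.transportSet (Γ ∩ Metric.ball x (δ / 4) ×ˢ Metric.ball y r) ∩
            Metric.ball (x : EuclideanSpace ℝ (Fin n)) δ) /
          volume (Metric.ball (x : EuclideanSpace ℝ (Fin n)) δ))
      (𝓝[>] 0) := by
  have hΩm : MeasurableSet Ω := hΩ_Gδ.measurableSet
  obtain ⟨y', r', _, _, hball, hfL, hgL, hf, hg⟩ := hxy.2 r hr
  have hπ1 := map_fst_of_mem_setO2 hπ
  set l : Measure Ω :=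
    ((π : Measure (Ω × Ω)).restrict (univ ×ˢ Metric.ball y' r')).map Prod.fst with hl
  have hle : l ≤ (π : Measure (Ω × Ω)).map Prod.fst :=
    Measure.map_mono Measure.restrict_le_self measurable_fst
  rw [hπ1] at hle hfL hf
  have hlac : l ≪ leb Ω := (Measure.absolutelyContinuous_of_le hle).trans hac
  have hab : density l x ≤ density (μ₁ : Measure Ω) x := density_mono hle x
  simp only at hfL hgL hf hg
  set b : ℝ≥0∞ := density (μ₁ : Measure Ω) x
  set a : ℝ≥0∞ := density l x
  have ha : a ≠ ∞ := (hab.trans_lt hf).ne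
  have ha4 : 0 < a / 4 := ENNReal.div_pos hg.ne' (by simp)
  have ha4' : a / 4 ≠ ∞ := ENNReal.div_ne_top ha (by simp)
  obtain ⟨κ, hκ, hκev⟩ := exists_volume_ball_le_leb_ball hΩm hΩ_conv hΩ_int x
  obtain ⟨D, hD⟩ := Metric.isBounded_iff.1 hΩ_bdd
  have hD' : ∀ z w : Ω, ‖(z : Eucl n) - w‖ ≤ |D| + 1 := fun z w => by
    rw [← dist_eq_norm]
    linarith [hD z.2 w.2, le_abs_self D]
  have hD0 : 0 < |D| + 1 := by positivity
  -- The set `S` of starting points found below fills at least the proportion `a / (4 b)` of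
  -- `B(x, δ / 4) ∩ Ω`, which fills the proportion `κ` of `B(x, δ / 4)`; the homotheties, of ratio
  -- at least `1 / 2`, account for the factor `(1 / 2) ^ n`.
  set c₀ : ℝ≥0∞ := ENNReal.ofReal ((1 / 2) ^ n) *
    (a / 4 / b * (ENNReal.ofReal κ * ENNReal.ofReal ((1 / 4) ^ n))) with hc₀
  have hc₀pos : 0 < c₀ := by
    have h1 : 0 < a / 4 / b := ENNReal.div_pos ha4.ne' hf.ne
    have h2 : 0 < ENNReal.ofReal κ := ENNReal.ofReal_pos.2 hκ
    have h3 : 0 < ENNReal.ofReal ((1 / 4) ^ n) := ENNReal.ofReal_pos.2 (by positivity)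
    have h4 : 0 < ENNReal.ofReal ((1 / 2) ^ n) := ENNReal.ofReal_pos.2 (by positivity)
    exact ENNReal.mul_pos h4.ne' (ENNReal.mul_pos h1.ne' (ENNReal.mul_pos h2.ne' h3.ne').ne').ne'
  refine hc₀pos.trans_le (le_liminf_of_le (by isBoundedDefault) ?_)
  have hdiv : Tendsto (fun δ : ℝ => δ / 4) (𝓝[>] 0) (𝓝[>] 0) := by
    refine tendsto_nhdsWithin_iff.2 ⟨?_, ?_⟩
    · exact ((continuous_id.div_const (4 : ℝ)).tendsto' 0 0 (by simp)).mono_left nhdsWithin_le_nhds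
    · filter_upwards [self_mem_nhdsWithin] with δ hδ
      exact div_pos (mem_Ioi.1 hδ) four_pos
  filter_upwards [hdiv.eventually (eventually_measure_le hΩm (μ₁ : Measure Ω) hac hfL ha4 ha4'),
    hdiv.eventually (eventually_le_measure_ball hΩm l hlac hgL ha4 ha4'), hdiv.eventually hκev,
    Ioo_mem_nhdsGT hD0] with δ hup hlow hvol hδ
  obtain ⟨hδ0, hδD⟩ := hδ
  set B : Set Ω := Metric.ball x (δ / 4) with hB
  set K : Set (Ω × Ω) := Γ ∩ B ×ˢ Metric.ball y r with hK
  set V : ℝ≥0∞ := volume (Metric.ball (x : EuclideanSpace ℝ (Fin n)) δ) with hVdef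
  have hV0 : V ≠ 0 := (Metric.measure_ball_pos _ _ hδ0).ne'
  have hVt : V ≠ ∞ := measure_ball_lt_top.ne
  have hL : ENNReal.ofReal κ * ENNReal.ofReal ((1 / 4) ^ n) * V ≤ leb Ω B := by
    refine le_trans (le_of_eq ?_) hvol
    have h4 : δ / 4 = 1 / 4 * δ := by ring
    rw [mul_assoc, h4, Measure.addHaar_ball_mul_of_pos _ _ (by norm_num),
      finrank_euclideanSpace_fin, hVdef, ← Measure.addHaar_ball_center volume (x : Eucl n)]
  have hLt : leb Ω B ≠ ∞ := ((leb_ball_le_volume hΩm x _).trans_lt measure_ball_lt_top).ne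
  have hL0 : leb Ω B ≠ 0 := by
    have h2 : ENNReal.ofReal κ ≠ 0 := (ENNReal.ofReal_pos.2 hκ).ne'
    have h3 : ENNReal.ofReal ((1 / 4) ^ n) ≠ 0 := (ENNReal.ofReal_pos.2 (by positivity)).ne'
    exact ((ENNReal.mul_pos (mul_ne_zero h2 h3) hV0).trans_le hL).ne'
  have hlK : l B ≤ (π : Measure (Ω × Ω)) K := by
    rw [hl, Measure.map_apply measurable_fst Metric.isOpen_ball.measurableSet,
      Measure.restrict_apply (measurable_fst Metric.isOpen_ball.measurableSet)]
    refine measure_mono_ae ?_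
    filter_upwards [show ∀ᵐ z ∂(π : Measure (Ω × Ω)), z ∈ Γ from hπΓ] with z hz hzB
    exact ⟨hz, hzB.1, hball hzB.2.2⟩
  have hquarter : a / 4 + a / 4 + (a / 4 + a / 4) = a := by
    rw [← two_mul, ← two_mul, ← mul_assoc]
    norm_num
    exact ENNReal.mul_div_cancel (by simp) (by simp)
  have haL : a / 4 * leb Ω B ≠ ∞ := ENNReal.mul_ne_top ha4' hLt
  have haL0 : a / 4 * leb Ω B ≠ 0 := mul_ne_zero ha4.ne' hL0
  -- Half of `a * leb Ω B` is a lower bound for the mass of `K`. The error term of the upper bound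
  -- for the mass of `S` will use up one of the two quarters.
  have hc : a / 4 * leb Ω B + a / 4 * leb Ω B < (π : Measure (Ω × Ω)) K := by
    refine lt_of_lt_of_le ?_ hlK
    have h : a / 4 * leb Ω B + a / 4 * leb Ω B + a / 4 * leb Ω B ≤ l B := by
      refine (ENNReal.add_le_add_iff_right haL).1 (le_trans (le_of_eq ?_) hlow)
      change _ = a * _
      conv_rhs => rw [← hquarter]
      ring
    exact (ENNReal.lt_add_right (ENNReal.add_ne_top.2 ⟨haL, haL⟩) haL0).trans_le h
  -- At this time the points have moved from `B(x, δ / 4)` by at most `δ / 4`.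
  set t : ℝ := δ / 4 / (|D| + 1) with ht
  have ht0 : 0 < t := by positivity
  have ht1 : t ≤ 1 / 2 := by
    rw [ht, div_le_iff₀ hD0]
    linarith
  have hsub : interp t '' K ⊆ transportSet K ∩ Metric.ball (x : EuclideanSpace ℝ (Fin n)) δ := by
    rintro _ ⟨z, hz, rfl⟩
    refine ⟨⟨z, hz, t, ⟨ht0.le, by linarith⟩, rfl⟩, ?_⟩
    have h1 : ‖(z.1 : Eucl n) - x‖ < δ / 4 := by
      rw [← dist_eq_norm]
      exact hz.2.1
    have h2 : interp t z - (x : Eucl n)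
        = ((z.1 : Eucl n) - x) + t • ((z.2 : Eucl n) - z.1) := by
      unfold interp
      module
    have h3 : ‖t • ((z.2 : Eucl n) - z.1)‖ ≤ δ / 4 := by
      rw [norm_smul, Real.norm_of_nonneg ht0.le]
      calc t * ‖(z.2 : Eucl n) - z.1‖ ≤ t * (|D| + 1) := by
            gcongr
            exact hD' _ _
        _ = δ / 4 := by rw [ht]; field_simp
    rw [Metric.mem_ball, dist_eq_norm, h2]
    linarith [norm_add_le ((z.1 : Eucl n) - x) (t • ((z.2 : Eucl n) - z.1))]
  rw [ENNReal.le_div_iff_mul_le (.inl hV0) (.inl hVt)]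
  refine le_trans ?_ (measure_mono hsub)
  by_contra! hlt
  obtain ⟨S, hSB, hSm, hcS, hSA⟩ := exists_leb_lt_of_mem_setO2 hΩm hΩ_conv hρ hA hμ₁ hμ₂ hπ
    Metric.isOpen_ball (fun p (hp : p ∈ K) => hp.2.1) ⟨ht0, by linarith⟩ hc hlt
  have hbS : a / 4 * leb Ω B ≤ b * leb Ω S :=
    ((ENNReal.add_lt_add_iff_right haL).1 (hcS.trans_le (hup S hSB hSm))).le
  have hS : a / 4 / b * leb Ω B ≤ leb Ω S := by
    rw [ENNReal.mul_div_right_comm.symm]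
    exact ENNReal.div_le_of_le_mul' hbS
  refine absurd hSA (not_lt.2 ?_)
  rw [hc₀, mul_assoc, mul_assoc]
  gcongr
  · linarith
  · exact (by gcongr : _ ≤ a / 4 / b * leb Ω B).trans hS
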